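/- Let $G$ be a finite simple graph. A set $D\subseteq V(G)$ is dominating if every vertex of $G$ lies in $D$ or has a neighbour in $D$, and $\gamma(G)$ is the smallest size of a dominating set. In the Maker-Breaker domination game on $G$, Dominator and Staller alternately select a vertex of $G$ that has not been selected before; Dominator wins if at some point the vertices he has selected form a dominating set, and otherwise Staller wins. Let $\gamma_{\rm MB}(G)$ be the least integer $k\ge 0$ such that Dominator, moving first, has a strategy that wins within at most $k$ of his own moves however Staller plays, and let $\gamma_{\rm MB}(G)=\infty$ if there is no such $k$. Let $\gamma_{\rm MB}'(G)\in\{0,1,2,\dots\}\cup\{\infty\}$ be defined in the same way for the game in which Staller moves first. **Theorem.** For every finite simple graph $G$, $$\gamma(G)\le\gamma_{\rm MB}(G)\le\gamma_{\rm MB}'(G).$$ Moreover, for all integers $2\le r\le s\le t$ there is a finite graph $G_{r,s,t}$ with $$\gamma(G_{r,s,t})=r,\qquad \gamma_{\rm MB}(G_{r,s,t})=s,\qquad \gamma_{\rm MB}'(G_{r,s,t})=t.$$ Namely, $G_{r,s,t}$ may be taken to be the path $x_1,\dots,x_r$ on $r$ vertices together with $t-r+1$ triangles attached at $x_1$, $s-r+1$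 triangles attached at $x_2$, and one new vertex of degree $1$ attached at each $x_i$ with $3\le i\le r$; here attaching a triangle at a vertex $x$ means adding two new vertices that are adjacent to each other and to $x$, and to nothing else. -/

import Mathlib

namespace MBDomination

/-- `D` is a dominating set of `G`: the closed neighbourhoods of the vertices of `D` cover `V`. -/
def IsDominating {V : Type*} (G : SimpleGraph V) (D : Set V) : Prop :=
  ∀ v : V, ∃ u ∈ D, v = u ∨ G.Adj u v

/-- The domination number: the size of a smallest dominating set of a finite graph. -/
noncomputable def dominationNumber {V : Type*} (G : SimpleGraph V) : ℕ :=
  sInf {n : ℕ | ∃ D : Finset V, D.card = n ∧ IsDominating G (D : Set V)}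

/-- A strategy of Dominator: to every history `h` (the list of the vertices selected so far, by
both players, in the order of selection) that leaves some vertex unplayed, it assigns an unplayed
vertex. -/
def Strategy (V : Type*) : Type _ :=
  ∀ h : List V, (∃ v : V, v ∉ h) → {v : V // v ∉ h}

/-- `l` is a play of the game: the players alternately select unplayed vertices until the board of
the (finite) graph is exhausted. Moves made after Dominator has won do not matter. -/
def IsPlay {V : Type*} (l : List V) : Prop :=
  l.Nodup ∧ ∀ v : V, v ∈ l

/-! In what follows, `b` is the number of moves that precede the first move of Dominator: `b = 0`
in the D-game (Dominator starts) and `b = 1` in the S-game (Staller starts). Since the moves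
alternate, the moves of Dominator are the entries of the play at the positions `b`, `b + 2`,
`b + 4`, ..., counted from `0`, and all the other entries are moves of Staller. -/

/-- In the play `l`, all moves of Dominator are made according to the strategy `σ`. -/
def Follows {V : Type*} (b : ℕ) (σ : Strategy V) (l : List V) : Prop :=
  ∀ (i : ℕ) (v : V), l[2 * i + b]? = some v →
    ∀ h : ∃ w : V, w ∉ l.take (2 * i + b), v = (σ (l.take (2 * i + b)) h).1

/-- The set of vertices that Dominator selects in his first `k` moves of the play `l` (in all of
his moves, if there are fewer than `k`). -/
def dominatorMoves {V : Type*} (b : ℕ) (l : List V) (k : ℕ) : Set V :=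
  {v : V | ∃ i < k, l[2 * i + b]? = some v}

/-- If Dominator uses the strategy `σ`, then, whatever Staller does, he wins the game after at
most `k` moves of his. -/
def WinsWithin {V : Type*} (G : SimpleGraph V) (b : ℕ) (σ : Strategy V) (k : ℕ) : Prop :=
  ∀ l : List V, IsPlay l → Follows b σ l → IsDominating G (dominatorMoves b l k)

/-- The least `k` such that Dominator has a strategy that wins within `k` of his moves, and `⊤` if
he has no winning strategy. -/
noncomputable def gameNumber {V : Type*} (G : SimpleGraph V) (b : ℕ) : ℕ∞ :=
  ⨅ (k : ℕ) (_ : ∃ σ : Strategy V, WinsWithin G b σ k), (k : ℕ∞)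

/-- The Maker-Breaker domination number of a finite graph (Dominator plays first). -/
noncomputable def gammaMB {V : Type*} (G : SimpleGraph V) : ℕ∞ := gameNumber G 0

/-- The Maker-Breaker domination number of a finite graph when Staller plays first. -/
noncomputable def gammaMB' {V : Type*} (G : SimpleGraph V) : ℕ∞ := gameNumber G 1

/-- The vertices of the graph `realizationGraph r s t`. -/
inductive RealizationVertex (r s t : ℕ) : Type
  /-- `x i` is the vertex `x_{i+1}` of the path `x_1, ..., x_r`. -/
  | x (i : Fin r)
  /-- The two further vertices of the `j`-th triangle at `x_1`. -/
  | triOne (j : Fin (t - r + 1)) (c : Bool)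
  /-- The two further vertices of the `j`-th triangle at `x_2`. -/
  | triTwo (j : Fin (s - r + 1)) (c : Bool)
  /-- `y i` is the pendant vertex `y_{i+3}` at `x_{i+3}`. -/
  | y (i : Fin (r - 2))
  deriving DecidableEq, Fintype

/-- Each edge of `realizationGraph r s t`, in at least one of its two directions. -/
def realizationRel (r s t : ℕ) : RealizationVertex r s t → RealizationVertex r s t → Prop
  | .x i, .x j => (i : ℕ) + 1 = j
  | .x i, .triOne _ _ => (i : ℕ) = 0
  | .x i, .triTwo _ _ => (i : ℕ) = 1
  | .x i, .y j => (i : ℕ) = j + 2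
  | .triOne j _, .triOne k _ => j = k
  | .triTwo j _, .triTwo k _ => j = k
  | _, _ => False

/-- For `2 ≤ r ≤ s ≤ t`: the path `x_1, ..., x_r` with `t - r + 1` pendant triangles attached at
`x_1`, `s - r + 1` pendant triangles attached at `x_2`, and a pendant vertex attached at each of
`x_3, ..., x_r`. (`SimpleGraph.fromRel` symmetrizes the relation and removes loops.) -/
def realizationGraph (r s t : ℕ) : SimpleGraph (RealizationVertex r s t) :=
  SimpleGraph.fromRel (realizationRel r s t)

end MBDomination

namespace MBDomination

variable {V : Type*}

/-! Winning strategies are traded for a recursion on positions `(D, P)`, with `D` Dominator's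
vertices and `P` all selected ones (`exists_winsWithin_zero_iff`, `exists_winsWithin_one_iff`).
Freeing vertices never hurts Dominator (`DomWins.mono`), so a move of Staller may be forgotten.
Forgetting one gives the second inequality; forgetting all of them leaves a dominating set of at
most `k` vertices (`DomWins.exists_isDominating`), which gives the first.

In the realization graph, a dominating set meets `r` disjoint blocks. If it misses `x_1`, it also
needs a vertex in every triangle there, so it has at least `t` elements; if it misses `x_2`, at
least `s`. Moving first, Staller takes `x_1`; moving second, she takes one of `x_1`, `x_2` that
Dominator left. Conversely, once Dominator owns `x_1` or `x_2`, he pairs the outer vertices of each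
triangle at the other one, and each pendant vertex with its neighbour
(`DomWinsAsSecond.of_pairing`); counting the pairs gives `s` and `t`. -/

theorem IsDominating.mono {G : SimpleGraph V} {D D' : Set V} (h : IsDominating G D)
    (hD : D ⊆ D') : IsDominating G D' := fun v =>
  let ⟨u, hu, huv⟩ := h v
  ⟨u, hD hu, huv⟩

/-! ### Dominator's moves in a growing history -/

theorem dominatorMoves_subset_append (b : ℕ) (h h' : List V) (k : ℕ) :
    dominatorMoves b h k ⊆ dominatorMoves b (h ++ h') k := by
  rintro v ⟨i, hi, hv⟩
  refine ⟨i, hi, ?_⟩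
  have hlt := (List.getElem?_eq_some_iff.1 hv).1
  rw [List.getElem?_append_left hlt, hv]

theorem dominatorMoves_concat_of_turn {b i k : ℕ} {h : List V} (v : V)
    (hl : h.length = 2 * i + b) (hi : i < k) :
    dominatorMoves b (h ++ [v]) k = insert v (dominatorMoves b h k) := by
  apply Set.Subset.antisymm
  · rintro w ⟨j, hj, hw⟩
    rcases lt_or_ge (2 * j + b) h.length with hlt | hge
    · rw [List.getElem?_append_left hlt] at hw
      exact Or.inr ⟨j, hj, hw⟩
    · rw [List.getElem?_append_right hge] at hw
      have hw' := List.mem_of_getElem? hw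
      exact Or.inl (by simpa using hw')
  · rintro w (rfl | hw)
    · exact ⟨i, hi, by rw [← hl]; simp⟩
    · exact dominatorMoves_subset_append b h _ k hw

theorem dominatorMoves_concat_of_not_turn {b k : ℕ} {h : List V} (v : V)
    (hl : ∀ i < k, h.length ≠ 2 * i + b) :
    dominatorMoves b (h ++ [v]) k = dominatorMoves b h k := by
  apply Set.Subset.antisymm _ (dominatorMoves_subset_append b h _ k)
  rintro w ⟨j, hj, hw⟩
  refine ⟨j, hj, ?_⟩
  rcases lt_or_ge (2 * j + b) h.length with hlt | hge
  · rwa [List.getElem?_append_left hlt] at hw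
  · have hlt := (List.getElem?_eq_some_iff.1 hw).1
    rw [List.length_append, List.length_singleton] at hlt
    exact absurd (by omega) (hl j hj)

theorem setOf_mem_concat (h : List V) (v : V) :
    {w | w ∈ h ++ [v]} = insert v {w | w ∈ h} := by
  ext w
  simp [or_comm]

/-! ### Winning histories -/

/-- The histories from which Dominator can force that his first `k` moves are dominating once the
board is exhausted. -/
inductive HistoryWins (G : SimpleGraph V) (b k : ℕ) : List V → Prop
  | full (h : List V) (hf : ∀ v, v ∈ h) (hd : IsDominating G (dominatorMoves b h k)) :
      HistoryWins G b k h
  | dom (h : List V) (i : ℕ) (hi : h.length = 2 * i + b) (v : V) (hv : v ∉ h)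
      (hw : HistoryWins G b k (h ++ [v])) : HistoryWins G b k h
  | stal (h : List V) (hi : ∀ i, h.length ≠ 2 * i + b) (hv : ∃ v, v ∉ h)
      (hw : ∀ v, v ∉ h → HistoryWins G b k (h ++ [v])) : HistoryWins G b k h

theorem card_unplayed_concat_lt [Finite V] {h : List V} {v : V} (hv : v ∉ h) :
    {w | w ∉ h ++ [v]}.ncard < {w | w ∉ h}.ncard := by
  apply Set.ncard_lt_ncard _ (Set.toFinite _)
  refine ⟨fun w hw hw' => hw (List.mem_append_left _ hw'), fun hs => ?_⟩
  exact hs (show v ∈ {w | w ∉ h} from hv) (by simp)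

/-- To win from every history of a class closed under suitable moves, it suffices to win at the
exhausted ones. -/
theorem historyWins_of_invariant [Finite V] {G : SimpleGraph V} {b k : ℕ} (I : List V → Prop)
    (hfull : ∀ h, I h → (∀ v, v ∈ h) → IsDominating G (dominatorMoves b h k))
    (hdom : ∀ h, I h → (∃ v, v ∉ h) → (∃ i, h.length = 2 * i + b) →
      ∃ v, v ∉ h ∧ I (h ++ [v]))
    (hstal : ∀ h, I h → (∀ i, h.length ≠ 2 * i + b) → ∀ v, v ∉ h → I (h ++ [v]))
    (h : List V) (hI : I h) : HistoryWins G b k h := by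
  induction hn : {w | w ∉ h}.ncard using Nat.strong_induction_on generalizing h with
  | _ n ih =>
    subst hn
    by_cases hf : ∀ v, v ∈ h
    · exact .full h hf (hfull h hI hf)
    push Not at hf
    by_cases ht : ∃ i, h.length = 2 * i + b
    · obtain ⟨v, hv, hv'⟩ := hdom h hI hf ht
      obtain ⟨i, hi⟩ := ht
      exact .dom h i hi v hv (ih _ (card_unplayed_concat_lt hv) _ hv' rfl)
    · push Not at ht
      exact .stal h ht hf fun v hv =>
        ih _ (card_unplayed_concat_lt hv) _ (hstal h hI ht v hv) rfl

theorem historyWins_of_isDominating [Finite V] {G : SimpleGraph V} {b k : ℕ} {h : List V}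
    (hd : IsDominating G (dominatorMoves b h k)) : HistoryWins G b k h :=
  historyWins_of_invariant (fun h => IsDominating G (dominatorMoves b h k))
    (fun _ hI _ => hI)
    (fun h hI ⟨v, hv⟩ _ => ⟨v, hv, hI.mono (dominatorMoves_subset_append b h _ k)⟩)
    (fun h hI _ _ _ => hI.mono (dominatorMoves_subset_append b h _ k)) h hd

theorem Follows.concat {b : ℕ} {σ : Strategy V} {h : List V} (hF : Follows b σ h) {v : V}
    (hv : ∀ i, h.length = 2 * i + b → ∀ hh : ∃ w, w ∉ h, v = (σ h hh).1) :
    Follows b σ (h ++ [v]) := by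
  intro i w hw
  rcases lt_or_ge (2 * i + b) h.length with hlt | hge
  · rw [List.getElem?_append_left hlt] at hw
    rw [List.take_append_of_le_length hlt.le]
    exact hF i w hw
  · have hlt := (List.getElem?_eq_some_iff.1 hw).1
    rw [List.length_append, List.length_singleton] at hlt
    have hl : h.length = 2 * i + b := by omega
    rw [← hl, List.take_left]
    rw [← hl] at hw
    have hvw : v = w := by simpa using hw
    subst hvw
    exact hv i hl

/-- The invariant is consistency with `σ`: an exhausted consistent history is a play, so `σ` has won
it. -/
theorem WinsWithin.historyWins [Finite V] {G : SimpleGraph V} {b k : ℕ} {σ : Strategy V}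
    (hσ : WinsWithin G b σ k) : HistoryWins G b k [] := by
  refine historyWins_of_invariant (fun h => h.Nodup ∧ Follows b σ h)
    (fun h hI hf => hσ h ⟨hI.1, hf⟩ hI.2) ?_ ?_ [] ⟨List.nodup_nil, ?_⟩
  · rintro h ⟨hn, hF⟩ hh -
    refine ⟨(σ h hh).1, (σ h hh).2, ?_, hF.concat fun _ _ _ => rfl⟩
    exact List.nodup_append.2 ⟨hn, List.nodup_singleton _, by
      rintro a ha _ hb rfl
      exact (σ h hh).2 (by rwa [List.mem_singleton.1 hb] at ha)⟩
  · rintro h ⟨hn, hF⟩ ht v hv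
    refine ⟨?_, hF.concat fun i hi => absurd hi (ht i)⟩
    exact List.nodup_append.2 ⟨hn, List.nodup_singleton _, by
      rintro a ha _ hb rfl
      exact hv (by rwa [List.mem_singleton.1 hb] at ha)⟩
  · intro i v hv
    simp at hv

/-- The strategy moves to a winning history whenever one is available; then all prefixes of a play
that follows it are winning. -/
theorem HistoryWins.exists_winsWithin {G : SimpleGraph V} {b k : ℕ}
    (hw : HistoryWins G b k []) : ∃ σ : Strategy V, WinsWithin G b σ k := by
  classical
  have hex : ∀ (h : List V) (hh : ∃ v, v ∉ h), ∃ v : {v : V // v ∉ h},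
      (∃ w, w ∉ h ∧ HistoryWins G b k (h ++ [w])) → HistoryWins G b k (h ++ [v.1]) := by
    intro h hh
    by_cases he : ∃ w, w ∉ h ∧ HistoryWins G b k (h ++ [w])
    · obtain ⟨w, hw, hw'⟩ := he
      exact ⟨⟨w, hw⟩, fun _ => hw'⟩
    · exact ⟨⟨hh.choose, hh.choose_spec⟩, fun h' => absurd h' he⟩
  choose σ hσ using hex
  refine ⟨σ, fun l hl hF => ?_⟩
  have key : ∀ n ≤ l.length, HistoryWins G b k (l.take n) := by
    intro n
    induction n with
    | zero => simpa using hw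
    | succ n ih =>
      intro hn
      have hlt : n < l.length := hn
      have htake : l.take (n + 1) = l.take n ++ [l[n]] := by simp
      have hmem : l[n] ∉ l.take n := by
        have := hl.1.sublist (List.take_sublist (n + 1) l)
        rw [htake, List.nodup_append] at this
        exact fun h => this.2.2 _ h _ (List.mem_singleton_self _) rfl
      have hlen : (l.take n).length = n := by simp [hlt.le]
      rw [htake]
      cases ih hlt.le with
      | full _ hf _ => exact absurd (hf _) hmem
      | dom _ i hi v hv hw' =>
        rw [hlen] at hi
        subst hi
        rw [hF i l[2 * i + b] (List.getElem?_eq_getElem hlt) ⟨v, hv⟩]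
        exact hσ _ ⟨v, hv⟩ ⟨v, hv, hw'⟩
      | stal _ _ _ hw' => exact hw' _ hmem
  have hfin := key l.length le_rfl
  rw [List.take_length] at hfin
  cases hfin with
  | full _ _ hd => exact hd
  | dom _ _ _ v hv _ => exact absurd (hl.2 v) hv
  | stal _ _ hv _ => exact absurd (hl.2 _) hv.choose_spec

/-! ### Positions -/

/-- Staller is to move, Dominator has selected `D`, and the set `P` has been selected by both
players. Dominator has won already, or Staller can move and all her moves lead to positions in
`W`. -/
def StallerTurn (G : SimpleGraph V) (W : Set V → Set V → Prop) (D P : Set V) : Prop :=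
  IsDominating G D ∨ ((∃ u, u ∉ P) ∧ ∀ u, u ∉ P → W D (insert u P))

/-- Dominator is to move, he has selected `D`, the set `P` has been selected by both players, and
he can win within `k` further moves. -/
def DomWins (G : SimpleGraph V) : ℕ → Set V → Set V → Prop
  | 0, D, _ => IsDominating G D
  | k + 1, D, P => IsDominating G D ∨
      ∃ v, v ∉ P ∧ StallerTurn G (DomWins G k) (insert v D) (insert v P)

/-- As `DomWins`, but Staller is to move. -/
def DomWinsAsSecond (G : SimpleGraph V) (k : ℕ) (D P : Set V) : Prop :=
  StallerTurn G (DomWins G k) D P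

theorem DomWins.of_isDominating {G : SimpleGraph V} {k : ℕ} {D P : Set V}
    (h : IsDominating G D) : DomWins G k D P := by
  cases k with
  | zero => exact h
  | succ k => exact Or.inl h

/-- In both clauses `i` counts the moves Dominator has made, so `k - i` of his counted moves remain.
-/
theorem HistoryWins.position {G : SimpleGraph V} {b k : ℕ} {h : List V}
    (hw : HistoryWins G b k h) :
    (∀ i, h.length = 2 * i + b → DomWins G (k - i) (dominatorMoves b h k) {v | v ∈ h}) ∧
    (∀ i, h.length + 1 = 2 * i + b →
      DomWinsAsSecond G (k - i) (dominatorMoves b h k) {v | v ∈ h}) := by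
  induction hw with
  | full h hf hd => exact ⟨fun i _ => .of_isDominating hd, fun i _ => Or.inl hd⟩
  | dom h i hi v hv _ ih =>
    refine ⟨fun j hj => ?_, fun j hj => by omega⟩
    obtain rfl : i = j := by omega
    have hS := ih.2 (i + 1) (by simp [hi]; ring)
    rcases lt_or_ge i k with hik | hik
    · obtain ⟨m, hm⟩ : ∃ m, k - i = m + 1 := ⟨k - i - 1, by omega⟩
      rw [dominatorMoves_concat_of_turn v hi hik, setOf_mem_concat,
        show k - (i + 1) = m by omega] at hS
      rw [hm]
      exact Or.inr ⟨v, hv, hS⟩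
    -- The first `k` moves are used up, so this one no longer counts and `D` must already be
    -- dominating.
    · rw [dominatorMoves_concat_of_not_turn v (fun j hj => by omega),
        show k - (i + 1) = 0 by omega] at hS
      rw [show k - i = 0 by omega]
      rcases hS with hS | ⟨⟨u, hu⟩, hS⟩
      · exact hS
      · exact hS u hu
  | stal h hi hv _ ih =>
    refine ⟨fun j hj => absurd hj (hi j), fun j hj => Or.inr ⟨hv, fun u hu => ?_⟩⟩
    have hD := (ih u hu).1 j (by simpa using hj)
    rwa [dominatorMoves_concat_of_not_turn u (fun i _ => hi i), setOf_mem_concat] at hD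

theorem StallerTurn.historyWins [Finite V] {G : SimpleGraph V} {b k : ℕ}
    {W : Set V → Set V → Prop} {h : List V} (ht : ∀ i, h.length ≠ 2 * i + b)
    (hS : StallerTurn G W (dominatorMoves b h k) {v | v ∈ h})
    (hW : ∀ u, W (dominatorMoves b (h ++ [u]) k) {v | v ∈ h ++ [u]} →
      HistoryWins G b k (h ++ [u])) : HistoryWins G b k h := by
  rcases hS with hd | ⟨hu, hS⟩
  · exact historyWins_of_isDominating hd
  · refine .stal h ht hu fun u hu => hW u ?_
    rw [dominatorMoves_concat_of_not_turn u (fun i _ => ht i), setOf_mem_concat]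
    exact hS u hu

theorem DomWins.historyWins [Finite V] {G : SimpleGraph V} {b k j i : ℕ} {h : List V}
    (hl : h.length = 2 * i + b) (hj : i + j = k)
    (hD : DomWins G j (dominatorMoves b h k) {v | v ∈ h}) : HistoryWins G b k h := by
  induction j generalizing i h with
  | zero => exact historyWins_of_isDominating hD
  | succ j ih =>
    rcases hD with hd | ⟨v, hv, hS⟩
    · exact historyWins_of_isDominating hd
    · refine .dom h i hl v hv ?_
      rw [← dominatorMoves_concat_of_turn v hl (by omega : i < k), ← setOf_mem_concat] at hS
      refine hS.historyWins (fun m => ?_) fun u hu => ih (i := i + 1) ?_ (by omega) hu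
      · simp only [List.length_append, List.length_singleton]; omega
      · simp only [List.length_append, List.length_singleton]; omega

theorem dominatorMoves_nil (b k : ℕ) : dominatorMoves b ([] : List V) k = ∅ := by
  ext v; simp [dominatorMoves]

theorem setOf_mem_nil : {v : V | v ∈ ([] : List V)} = ∅ := by simp

theorem exists_winsWithin_zero_iff [Finite V] {G : SimpleGraph V} {k : ℕ} :
    (∃ σ, WinsWithin G 0 σ k) ↔ DomWins G k ∅ ∅ := by
  constructor
  · rintro ⟨σ, hσ⟩
    have := hσ.historyWins.position.1 0 rfl
    rwa [dominatorMoves_nil, setOf_mem_nil] at this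
  · intro h
    refine (DomWins.historyWins (i := 0) (j := k) rfl (by omega) ?_).exists_winsWithin
    rwa [dominatorMoves_nil, setOf_mem_nil]

theorem exists_winsWithin_one_iff [Finite V] {G : SimpleGraph V} {k : ℕ} :
    (∃ σ, WinsWithin G 1 σ k) ↔ DomWinsAsSecond G k ∅ ∅ := by
  constructor
  · rintro ⟨σ, hσ⟩
    have := hσ.historyWins.position.2 0 rfl
    rwa [dominatorMoves_nil, setOf_mem_nil] at this
  · intro h
    refine HistoryWins.exists_winsWithin (StallerTurn.historyWins (W := DomWins G k) ?_ ?_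
      fun u hu => DomWins.historyWins (i := 0) rfl (by omega) hu)
    · intro i; simp
    · rwa [dominatorMoves_nil, setOf_mem_nil]

/-- Fewer selected vertices outside `D` are no disadvantage for Dominator. -/
theorem DomWins.mono {G : SimpleGraph V} {k : ℕ} {D P P' : Set V} (h : DomWins G k D P)
    (hP : P' ⊆ P) : DomWins G k D P' := by
  induction k generalizing D P P' with
  | zero => exact h
  | succ k ih =>
    rcases h with hd | ⟨v, hv, hS⟩
    · exact Or.inl hd
    refine Or.inr ⟨v, fun h => hv (hP h), ?_⟩
    rcases hS with hd | ⟨⟨w, hw⟩, hS⟩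
    · exact Or.inl hd
    have hP' := Set.insert_subset_insert (a := v) hP
    refine Or.inr ⟨⟨w, fun h => hw (hP' h)⟩, fun u _ => ?_⟩
    -- If Staller's move is illegal in the larger position, any legal move `w` there replaces it:
    -- the set she leaves is still smaller.
    by_cases hu : u ∈ insert v P
    · exact ih (hS w hw)
        (Set.insert_subset (Set.mem_insert_of_mem _ hu) (hP'.trans (Set.subset_insert _ _)))
    · exact ih (hS u hu) (Set.insert_subset_insert hP')

/-! ### Inequalities for arbitrary graphs -/

theorem DomWinsAsSecond.domWins {G : SimpleGraph V} {k : ℕ} {D P : Set V}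
    (h : DomWinsAsSecond G k D P) : DomWins G k D P := by
  rcases h with hd | ⟨⟨u, hu⟩, hS⟩
  · exact .of_isDominating hd
  · exact (hS u hu).mono (Set.subset_insert _ _)

/-- Staller in effect passes from now on. As `E` avoids `P`, a vertex she has taken earlier is
missing from it; the lower bounds rest on this. -/
theorem DomWins.exists_isDominating {G : SimpleGraph V} {k : ℕ} {D P : Set V}
    (h : DomWins G k D P) :
    ∃ E : Finset V, E.card ≤ k ∧ (∀ v ∈ E, v ∉ P) ∧ IsDominating G (D ∪ E) := by
  classical
  induction k generalizing D P with
  | zero => exact ⟨∅, by simp, by simp, by simpa [DomWins] using h⟩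
  | succ k ih =>
    rcases h with hd | ⟨v, hv, hS⟩
    · exact ⟨∅, by simp, by simp, by simpa using hd⟩
    obtain ⟨E, hE, hP, hd⟩ := ih (DomWinsAsSecond.domWins hS)
    refine ⟨insert v E, (Finset.card_insert_le _ _).trans (by omega), ?_, ?_⟩
    · intro w hw
      rcases Finset.mem_insert.1 hw with rfl | hw
      · exact hv
      · exact fun h => hP w hw (Set.mem_insert_of_mem _ h)
    · convert hd using 1
      simp [Set.insert_union, Set.union_insert]

theorem dominationNumber_le {G : SimpleGraph V} {E : Finset V}
    (h : IsDominating G (E : Set V)) : dominationNumber G ≤ E.card :=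
  Nat.sInf_le ⟨E, rfl, h⟩

theorem dominationNumber_le_gammaMB [Finite V] (G : SimpleGraph V) :
    (dominationNumber G : ℕ∞) ≤ gammaMB G := by
  refine le_iInf₂ fun k hk => ?_
  obtain ⟨E, hE, -, hd⟩ := (exists_winsWithin_zero_iff.1 hk).exists_isDominating
  rw [Set.empty_union] at hd
  exact_mod_cast (dominationNumber_le hd).trans hE

theorem gammaMB_le_gammaMB' [Finite V] (G : SimpleGraph V) : gammaMB G ≤ gammaMB' G :=
  le_iInf₂ fun k hk => iInf₂_le k
    (exists_winsWithin_zero_iff.2 (exists_winsWithin_one_iff.1 hk).domWins)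

/-- Pairing strategy: Dominator wins if any selection from disjoint pairs of free vertices
completes his set to a dominating set. -/
theorem DomWinsAsSecond.of_pairing {G : SimpleGraph V} {ι : Type*} [DecidableEq ι] (a b : ι → V)
    {k : ℕ} {D P : Set V} (Q : Finset ι) (hk : Q.card ≤ k)
    (hfree : ∀ i ∈ Q, a i ∉ P ∧ b i ∉ P) (hab : ∀ i ∈ Q, a i ≠ b i)
    (hdisj : ∀ i ∈ Q, ∀ j ∈ Q, i ≠ j → a i ≠ a j ∧ a i ≠ b j ∧ b i ≠ b j)
    (hdom : ∀ D', D ⊆ D' → (∀ i ∈ Q, a i ∈ D' ∨ b i ∈ D') → IsDominating G D') :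
    DomWinsAsSecond G k D P := by
  induction k generalizing D P Q with
  | zero =>
    obtain rfl : Q = ∅ := by simpa using hk
    exact Or.inl (hdom D subset_rfl (by simp))
  | succ k ih =>
    rcases Q.eq_empty_or_nonempty with rfl | ⟨i₀, hi₀⟩
    · exact Or.inl (hdom D subset_rfl (by simp))
    refine Or.inr ⟨⟨a i₀, (hfree i₀ hi₀).1⟩, fun u hu => Or.inr ?_⟩
    -- If `u` hits a pair, Dominator takes its other vertex; otherwise he settles the arbitrary pair
    -- `i₀`. Either way one pair is used up and the others stay free.
    have reply : ∃ i ∈ Q, (∀ j ∈ Q, j ≠ i → a j ≠ u ∧ b j ≠ u) ∧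
        ∃ v, (v = a i ∨ v = b i) ∧ v ≠ u := by
      by_cases hui : ∃ i ∈ Q, a i = u ∨ b i = u
      · obtain ⟨i, hi, hui⟩ := hui
        refine ⟨i, hi, fun j hj hji => ?_, ?_⟩
        · have h1 := hdisj j hj i hi hji
          have h2 := hdisj i hi j hj hji.symm
          rcases hui with rfl | rfl
          · exact ⟨h1.1, h2.2.1.symm⟩
          · exact ⟨h1.2.1, h1.2.2⟩
        · rcases hui with rfl | rfl
          · exact ⟨b i, Or.inr rfl, (hab i hi).symm⟩
          · exact ⟨a i, Or.inl rfl, hab i hi⟩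
      · push Not at hui
        exact ⟨i₀, hi₀, fun j hj _ => hui j hj, a i₀, Or.inl rfl, (hui i₀ hi₀).1⟩
    obtain ⟨i, hi, hne, v, hv, hvu⟩ := reply
    have hvP : v ∉ P := by
      rcases hv with rfl | rfl
      · exact (hfree i hi).1
      · exact (hfree i hi).2
    refine ⟨v, by simp [hvu, hvP], ih (Q.erase i) ?_ ?_ ?_ ?_ ?_⟩
    · rw [Finset.card_erase_of_mem hi]; omega
    · intro j hj
      obtain ⟨hji, hj⟩ := Finset.mem_erase.1 hj
      have h1 := hdisj j hj i hi hji
      have h2 := hdisj i hi j hj hji.symm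
      have h3 := hne j hj hji
      have h4 := hfree j hj
      rcases hv with rfl | rfl
      · simp [h1.1, h2.2.1.symm, h3, h4]
      · simp [h1.2.1, h1.2.2, h3, h4]
    · exact fun j hj => hab j (Finset.mem_of_mem_erase hj)
    · exact fun j hj l hl => hdisj j (Finset.mem_of_mem_erase hj) l (Finset.mem_of_mem_erase hl)
    · intro D' hD hQ
      refine hdom D' ((Set.subset_insert _ _).trans hD) fun j hj => ?_
      by_cases hji : j = i
      · subst hji
        have hvD := hD (Set.mem_insert _ _)
        rcases hv with rfl | rfl
        · exact Or.inl hvD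
        · exact Or.inr hvD
      · exact hQ j (Finset.mem_erase.2 ⟨hji, hj⟩)

end MBDomination

namespace MBDomination

/-! ### The realization graph -/

section Realization

variable {r s t : ℕ}

/-- The spine vertex to which the `i`-th pendant vertex is attached. -/
def spine (i : Fin (r - 2)) : RealizationVertex r s t := .x ⟨i + 2, by omega⟩

theorem realizationGraph_isDominating (hr : 2 ≤ r) {D : Set (RealizationVertex r s t)}
    (h01 : .x ⟨0, by omega⟩ ∈ D ∨ .x ⟨1, by omega⟩ ∈ D)
    (h0 : .x ⟨0, by omega⟩ ∈ D ∨ ∀ j, .triOne j true ∈ D ∨ .triOne j false ∈ D)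
    (h1 : .x ⟨1, by omega⟩ ∈ D ∨ ∀ j, .triTwo j true ∈ D ∨ .triTwo j false ∈ D)
    (hy : ∀ i, spine i ∈ D ∨ .y i ∈ D) : IsDominating (realizationGraph r s t) D := by
  have key : ∀ {u v : RealizationVertex r s t}, u ∈ D →
      (v = u ∨ realizationRel r s t u v ∨ realizationRel r s t v u) →
      ∃ u ∈ D, v = u ∨ (realizationGraph r s t).Adj u v := by
    intro u v hu h
    refine ⟨u, hu, ?_⟩
    by_cases hvu : v = u
    · exact Or.inl hvu
    · exact Or.inr ((SimpleGraph.fromRel_adj _ _ _).2 ⟨Ne.symm hvu, h.resolve_left hvu⟩)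
  rintro (⟨i, hi⟩ | ⟨j, c⟩ | ⟨j, c⟩ | i)
  · match i, hi with
    | 0, _ => rcases h01 with h | h <;> exact key h (by simp [realizationRel])
    | 1, _ => rcases h01 with h | h <;> exact key h (by simp [realizationRel])
    | i + 2, hi =>
      rcases hy ⟨i, by omega⟩ with h | h <;> exact key h (by simp [realizationRel, spine])
  · rcases h0 with h | h
    · exact key h (by simp [realizationRel])
    · rcases h j with h | h <;> exact key h (by simp [realizationRel])
  · rcases h1 with h | h
    · exact key h (by simp [realizationRel])
    · rcases h j with h | h <;> exact key h (by simp [realizationRel])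
  · rcases hy i with h | h <;> exact key h (by simp [realizationRel, spine])

theorem IsDominating.triOne_cover (hr : 2 ≤ r) {D : Set (RealizationVertex r s t)}
    (hD : IsDominating (realizationGraph r s t) D) (j : Fin (t - r + 1)) :
    .x ⟨0, by omega⟩ ∈ D ∨ ∃ c, .triOne j c ∈ D := by
  obtain ⟨u, hu, rfl | h⟩ := hD (.triOne j true)
  · exact Or.inr ⟨_, hu⟩
  · replace h := ((SimpleGraph.fromRel_adj _ _ _).1 h).2
    rcases u with ⟨i, hi⟩ | ⟨l, c⟩ | ⟨l, c⟩ | i <;> simp [realizationRel] at h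
    · subst h; exact Or.inl hu
    · rcases h with rfl | rfl <;> exact Or.inr ⟨_, hu⟩

theorem IsDominating.triTwo_cover (hr : 2 ≤ r) {D : Set (RealizationVertex r s t)}
    (hD : IsDominating (realizationGraph r s t) D) (j : Fin (s - r + 1)) :
    .x ⟨1, by omega⟩ ∈ D ∨ ∃ c, .triTwo j c ∈ D := by
  obtain ⟨u, hu, rfl | h⟩ := hD (.triTwo j true)
  · exact Or.inr ⟨_, hu⟩
  · replace h := ((SimpleGraph.fromRel_adj _ _ _).1 h).2
    rcases u with ⟨i, hi⟩ | ⟨l, c⟩ | ⟨l, c⟩ | i <;> simp [realizationRel] at h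
    · subst h; exact Or.inl hu
    · rcases h with rfl | rfl <;> exact Or.inr ⟨_, hu⟩

theorem IsDominating.pendant_cover {D : Set (RealizationVertex r s t)}
    (hD : IsDominating (realizationGraph r s t) D) (i : Fin (r - 2)) :
    spine i ∈ D ∨ .y i ∈ D := by
  obtain ⟨u, hu, rfl | h⟩ := hD (.y i)
  · exact Or.inr hu
  · replace h := ((SimpleGraph.fromRel_adj _ _ _).1 h).2
    rcases u with ⟨j, hj⟩ | ⟨l, c⟩ | ⟨l, c⟩ | j <;> simp [realizationRel] at h
    subst h; exact Or.inl hu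

/-! ### Lower bounds -/

theorem le_card_of_label {V : Type*} {n : ℕ} (E : Finset V) (l : V → ℕ)
    (h : ∀ m < n, ∃ v ∈ E, l v = m) : n ≤ E.card := by
  have hs : Finset.range n ⊆ E.image l := fun m hm =>
    Finset.mem_image.2 (h m (Finset.mem_range.1 hm))
  simpa using (Finset.card_le_card hs).trans Finset.card_image_le

/-- The label of a vertex is the index of the spine vertex it hangs from; every label below `r` must
occur in `E`. -/
theorem le_card_of_isDominating (hr : 2 ≤ r) {E : Finset (RealizationVertex r s t)}
    (hE : IsDominating (realizationGraph r s t) (E : Set _)) : r ≤ E.card := by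
  refine le_card_of_label E (fun
    | .x i => i
    | .triOne _ _ => 0
    | .triTwo _ _ => 1
    | .y i => i + 2) fun m hm => ?_
  match m, hm with
  | 0, _ => rcases hE.triOne_cover hr 0 with h | ⟨c, h⟩ <;> exact ⟨_, h, rfl⟩
  | 1, _ => rcases hE.triTwo_cover hr 0 with h | ⟨c, h⟩ <;> exact ⟨_, h, rfl⟩
  | m + 2, hm => rcases hE.pendant_cover ⟨m, by omega⟩ with h | h <;> exact ⟨_, h, rfl⟩

/-- Without `x_2`, each triangle there needs its own vertex. The first keeps label `1`; the other `s
- r` get the labels `r, ..., s - 1`. -/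
theorem le_card_of_x_one_notMem (hr : 2 ≤ r) (hrs : r ≤ s)
    {E : Finset (RealizationVertex r s t)}
    (hE : IsDominating (realizationGraph r s t) (E : Set _)) (hx : .x ⟨1, by omega⟩ ∉ E) :
    s ≤ E.card := by
  refine le_card_of_label E (fun
    | .x i => i
    | .triOne _ _ => 0
    | .triTwo j _ => if (j : ℕ) = 0 then 1 else r + j - 1
    | .y i => i + 2) fun m hm => ?_
  match m, hm with
  | 0, _ => rcases hE.triOne_cover hr 0 with h | ⟨c, h⟩ <;> exact ⟨_, h, rfl⟩
  | 1, _ =>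
    obtain ⟨c, h⟩ := (hE.triTwo_cover hr 0).resolve_left hx
    exact ⟨_, h, by simp⟩
  | m + 2, hm =>
    by_cases hmr : m + 2 < r
    · rcases hE.pendant_cover ⟨m, by omega⟩ with h | h <;> exact ⟨_, h, rfl⟩
    · obtain ⟨c, h⟩ := (hE.triTwo_cover hr ⟨m + 2 - r + 1, by omega⟩).resolve_left hx
      exact ⟨_, h, by simp; omega⟩

theorem le_card_of_x_zero_notMem (hr : 2 ≤ r) (hrt : r ≤ t)
    {E : Finset (RealizationVertex r s t)}
    (hE : IsDominating (realizationGraph r s t) (E : Set _)) (hx : .x ⟨0, by omega⟩ ∉ E) :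
    t ≤ E.card := by
  refine le_card_of_label E (fun
    | .x i => i
    | .triTwo _ _ => 1
    | .triOne j _ => if (j : ℕ) = 0 then 0 else r + j - 1
    | .y i => i + 2) fun m hm => ?_
  match m, hm with
  | 0, _ =>
    obtain ⟨c, h⟩ := (hE.triOne_cover hr 0).resolve_left hx
    exact ⟨_, h, by simp⟩
  | 1, _ => rcases hE.triTwo_cover hr 0 with h | ⟨c, h⟩ <;> exact ⟨_, h, rfl⟩
  | m + 2, hm =>
    by_cases hmr : m + 2 < r
    · rcases hE.pendant_cover ⟨m, by omega⟩ with h | h <;> exact ⟨_, h, rfl⟩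
    · obtain ⟨c, h⟩ := (hE.triOne_cover hr ⟨m + 2 - r + 1, by omega⟩).resolve_left hx
      exact ⟨_, h, by simp; omega⟩

theorem not_isDominating_empty (hr : 2 ≤ r) :
    ¬ IsDominating (realizationGraph r s t) ∅ := fun h => by
  obtain ⟨u, hu, -⟩ := h (.x ⟨0, by omega⟩)
  exact hu

theorem not_isDominating_singleton (hr : 2 ≤ r) (v : RealizationVertex r s t) :
    ¬ IsDominating (realizationGraph r s t) {v} := fun h => by
  have := le_card_of_isDominating hr (E := {v}) (by simpa using h)
  simp at this
  omega

theorem le_of_domWinsAsSecond (hr : 2 ≤ r) (hrt : r ≤ t) {k : ℕ}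
    (h : DomWinsAsSecond (realizationGraph r s t) k ∅ ∅) : t ≤ k := by
  rcases h with hd | ⟨-, h⟩
  · exact absurd hd (not_isDominating_empty hr)
  obtain ⟨E, hE, hP, hd⟩ := (h (.x ⟨0, by omega⟩) (by simp)).exists_isDominating
  rw [Set.empty_union] at hd
  exact (le_card_of_x_zero_notMem hr hrt hd fun h => hP _ h (by simp)).trans hE

theorem le_of_domWins (hr : 2 ≤ r) (hrs : r ≤ s) (hst : s ≤ t) {k : ℕ}
    (h : DomWins (realizationGraph r s t) k ∅ ∅) : s ≤ k := by
  classical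
  match k, h with
  | 0, h => exact absurd h (not_isDominating_empty hr)
  | k + 1, h =>
    rcases h with hd | ⟨v, -, hS⟩
    · exact absurd hd (not_isDominating_empty hr)
    rcases hS with hd | ⟨-, hS⟩
    · rw [insert_empty_eq] at hd
      exact absurd hd (not_isDominating_singleton hr v)
    have key : ∀ w, w ≠ v → ∃ E : Finset (RealizationVertex r s t), E.card ≤ k + 1 ∧
        IsDominating (realizationGraph r s t) (E : Set _) ∧ w ∉ E := by
      intro w hw
      obtain ⟨E, hE, hP, hd⟩ := (hS w (by simpa using hw)).exists_isDominating
      refine ⟨insert v E, (Finset.card_insert_le _ _).trans (by omega), ?_, ?_⟩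
      · convert hd using 1
        simp
      · simp only [Finset.mem_insert, not_or]
        exact ⟨hw, fun h => hP w h (by simp)⟩
    -- Staller answers at `x_2` if it is free. Otherwise she takes `x_1`, which costs Dominator `t ≥
    -- s` moves.
    by_cases hv : v = .x ⟨1, by omega⟩
    · obtain ⟨E, hE, hd, hx⟩ := key (.x ⟨0, by omega⟩) (by simp [hv])
      exact hst.trans ((le_card_of_x_zero_notMem hr (hrs.trans hst) hd hx).trans hE)
    · obtain ⟨E, hE, hd, hx⟩ := key (.x ⟨1, by omega⟩) (Ne.symm hv)
      exact (le_card_of_x_one_notMem hr hrs hd hx).trans hE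

/-! ### Upper bounds -/

/-- `x_1` dominates itself, `x_2` and its own triangles. What remains splits into pairs: the
triangles at `x_2` and the unsettled pendant edges in `Q`. -/
theorem domWinsAsSecond_of_x_zero_mem (hr : 2 ≤ r) {k : ℕ} {D P : Set (RealizationVertex r s t)}
    (Q : Finset (Fin (r - 2))) (hx : .x ⟨0, by omega⟩ ∈ D)
    (htri : ∀ j c, .triTwo j c ∉ P) (hQ : ∀ i ∈ Q, spine i ∉ P ∧ .y i ∉ P)
    (hD : ∀ i ∉ Q, spine i ∈ D ∨ .y i ∈ D) (hk : Q.card + (s - r + 1) ≤ k) :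
    DomWinsAsSecond (realizationGraph r s t) k D P := by
  refine DomWinsAsSecond.of_pairing (ι := Fin (s - r + 1) ⊕ Fin (r - 2))
    (Sum.elim (fun j => .triTwo j true) spine) (Sum.elim (fun j => .triTwo j false) .y)
    (Finset.univ.disjSum Q) ?_ ?_ ?_ ?_ ?_
  · rw [Finset.card_disjSum, Finset.card_univ, Fintype.card_fin]; omega
  · rintro (j | i) hi
    · exact ⟨htri _ _, htri _ _⟩
    · exact hQ i (by simpa using hi)
  · rintro (j | i) - <;> simp [spine]
  · rintro (j | i) - (l | m) - h <;> simp_all [spine, Fin.ext_iff]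
  · intro D' hDD' h
    refine realizationGraph_isDominating hr (Or.inl (hDD' hx)) (Or.inl (hDD' hx))
      (Or.inr fun j => h (.inl j) (by simp)) fun i => ?_
    by_cases hi : i ∈ Q
    · exact h (.inr i) (by simpa using hi)
    · exact (hD i hi).imp (@hDD' _) (@hDD' _)

theorem domWinsAsSecond_of_x_one_mem (hr : 2 ≤ r) {k : ℕ} {D P : Set (RealizationVertex r s t)}
    (Q : Finset (Fin (r - 2))) (hx : .x ⟨1, by omega⟩ ∈ D)
    (htri : ∀ j c, .triOne j c ∉ P) (hQ : ∀ i ∈ Q, spine i ∉ P ∧ .y i ∉ P)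
    (hD : ∀ i ∉ Q, spine i ∈ D ∨ .y i ∈ D) (hk : Q.card + (t - r + 1) ≤ k) :
    DomWinsAsSecond (realizationGraph r s t) k D P := by
  refine DomWinsAsSecond.of_pairing (ι := Fin (t - r + 1) ⊕ Fin (r - 2))
    (Sum.elim (fun j => .triOne j true) spine) (Sum.elim (fun j => .triOne j false) .y)
    (Finset.univ.disjSum Q) ?_ ?_ ?_ ?_ ?_
  · rw [Finset.card_disjSum, Finset.card_univ, Fintype.card_fin]; omega
  · rintro (j | i) hi
    · exact ⟨htri _ _, htri _ _⟩
    · exact hQ i (by simpa using hi)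
  · rintro (j | i) - <;> simp [spine]
  · rintro (j | i) - (l | m) - h <;> simp_all [spine, Fin.ext_iff]
  · intro D' hDD' h
    refine realizationGraph_isDominating hr (Or.inr (hDD' hx))
      (Or.inr fun j => h (.inl j) (by simp)) (Or.inl (hDD' hx)) fun i => ?_
    by_cases hi : i ∈ Q
    · exact h (.inr i) (by simpa using hi)
    · exact (hD i hi).imp (@hDD' _) (@hDD' _)

theorem domWins_realizationGraph (hr : 2 ≤ r) (hrs : r ≤ s) :
    DomWins (realizationGraph r s t) s ∅ ∅ := by
  obtain ⟨k, rfl⟩ : ∃ k, s = k + 1 := ⟨s - 1, by omega⟩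
  refine Or.inr ⟨.x ⟨0, by omega⟩, by simp, ?_⟩
  refine domWinsAsSecond_of_x_zero_mem hr Finset.univ (by simp) (by simp) (by simp [spine])
    (by simp) ?_
  -- After `x_1`, there are `(r - 2) + (s - r + 1) = s - 1` pairs.
  rw [Finset.card_univ, Fintype.card_fin]; omega

/-- As long as Staller plays at the pendant vertices, Dominator replies there. Once she plays
elsewhere, he takes one of the first two spine vertices and continues with a pairing strategy. -/
theorem domWinsAsSecond_of_intact (hr : 2 ≤ r) (hst : s ≤ t) {k : ℕ}
    {D P : Set (RealizationVertex r s t)} (Q : Finset (Fin (r - 2)))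
    (hx0 : .x ⟨0, by omega⟩ ∉ P) (hx1 : .x ⟨1, by omega⟩ ∉ P)
    (hone : ∀ j c, .triOne j c ∉ P) (htwo : ∀ j c, .triTwo j c ∉ P)
    (hQ : ∀ i ∈ Q, spine i ∉ P ∧ .y i ∉ P)
    (hD : ∀ i ∉ Q, spine i ∈ D ∨ .y i ∈ D) (hk : Q.card + (t - r + 1) + 1 ≤ k) :
    DomWinsAsSecond (realizationGraph r s t) k D P := by
  induction k generalizing D P Q with
  | zero => omega
  | succ k ih =>
  refine Or.inr ⟨⟨_, hx0⟩, fun u hu => Or.inr ?_⟩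
  have replyZero (h0 : u ≠ .x ⟨0, by omega⟩) (htri : ∀ j c, u ≠ .triTwo j c)
      (hp : ∀ i ∈ Q, u ≠ spine i ∧ u ≠ .y i) :
      ∃ v, v ∉ insert u P ∧ StallerTurn (realizationGraph r s t)
        (DomWins (realizationGraph r s t) k) (insert v D) (insert v (insert u P)) := by
    refine ⟨.x ⟨0, by omega⟩, by simp [hx0, h0.symm],
      domWinsAsSecond_of_x_zero_mem hr Q (by simp) ?_ ?_ ?_ (by omega)⟩
    · intro j c
      simp [htwo, (htri j c).symm]
    · intro i hi
      simp only [Set.mem_insert_iff, not_or]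
      exact ⟨⟨by simp [spine], (hp i hi).1.symm, (hQ i hi).1⟩, by simp, (hp i hi).2.symm,
        (hQ i hi).2⟩
    · exact fun i hi => (hD i hi).imp (Set.mem_insert_of_mem _) (Set.mem_insert_of_mem _)
  have replyOne (h1 : u ≠ .x ⟨1, by omega⟩) (htri : ∀ j c, u ≠ .triOne j c)
      (hp : ∀ i ∈ Q, u ≠ spine i ∧ u ≠ .y i) :
      ∃ v, v ∉ insert u P ∧ StallerTurn (realizationGraph r s t)
        (DomWins (realizationGraph r s t) k) (insert v D) (insert v (insert u P)) := by
    refine ⟨.x ⟨1, by omega⟩, by simp [hx1, h1.symm],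
      domWinsAsSecond_of_x_one_mem hr Q (by simp) ?_ ?_ ?_ (by omega)⟩
    · intro j c
      simp [hone, (htri j c).symm]
    · intro i hi
      simp only [Set.mem_insert_iff, not_or]
      exact ⟨⟨by simp [spine], (hp i hi).1.symm, (hQ i hi).1⟩, by simp, (hp i hi).2.symm,
        (hQ i hi).2⟩
    · exact fun i hi => (hD i hi).imp (Set.mem_insert_of_mem _) (Set.mem_insert_of_mem _)
  -- Outside the open pendant pairs, `u` cannot spoil both plans: after `x_1` or a triangle at `x_2`
  -- Dominator takes `x_2`, otherwise `x_1`.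
  by_cases hp : ∀ i ∈ Q, u ≠ spine i ∧ u ≠ .y i
  · rcases u with ⟨i, hi⟩ | ⟨j, c⟩ | ⟨j, c⟩ | i
    · by_cases h0 : i = 0
      · exact replyOne (by simp [h0]) (by simp) hp
      · exact replyZero (by simp [h0]) (by simp) hp
    · exact replyZero (by simp) (by simp) hp
    · exact replyOne (by simp) (by simp) hp
    · exact replyZero (by simp) (by simp) hp
  · push Not at hp
    obtain ⟨i, hi, hui⟩ := hp
    have reply : ∃ v : RealizationVertex r s t,
        (u = spine i ∧ v = .y i) ∨ (u = .y i ∧ v = spine i) := by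
      by_cases hus : u = spine i
      · exact ⟨_, Or.inl ⟨hus, rfl⟩⟩
      · exact ⟨_, Or.inr ⟨hui hus, rfl⟩⟩
    obtain ⟨v, huv⟩ := reply
    have hQi := hQ i hi
    refine ⟨v, ?_, ih (Q.erase i) ?_ ?_ ?_ ?_ ?_ ?_ ?_⟩
    · rcases huv with ⟨rfl, rfl⟩ | ⟨rfl, rfl⟩
      · simpa [spine] using hQi.2
      · simpa [spine] using hQi.1
    · rcases huv with ⟨rfl, rfl⟩ | ⟨rfl, rfl⟩ <;> simp [hx0, spine]
    · rcases huv with ⟨rfl, rfl⟩ | ⟨rfl, rfl⟩ <;> simp [hx1, spine]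
    · rcases huv with ⟨rfl, rfl⟩ | ⟨rfl, rfl⟩ <;> simp [hone, spine]
    · rcases huv with ⟨rfl, rfl⟩ | ⟨rfl, rfl⟩ <;> simp [htwo, spine]
    · intro j hj
      obtain ⟨hji, hj⟩ := Finset.mem_erase.1 hj
      obtain ⟨hs, hy⟩ := hQ j hj
      have hval : (j : ℕ) ≠ i := fun h => hji (Fin.ext h)
      unfold spine at hs huv ⊢
      rcases huv with ⟨rfl, rfl⟩ | ⟨rfl, rfl⟩ <;> simp [hs, hy, hji, hval]
    · intro j hj
      by_cases hji : j = i
      · subst hji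
        rcases huv with ⟨rfl, rfl⟩ | ⟨rfl, rfl⟩
        · exact Or.inr (Set.mem_insert _ _)
        · exact Or.inl (Set.mem_insert _ _)
      · exact (hD j fun h => hj (Finset.mem_erase.2 ⟨hji, h⟩)).imp
          (Set.mem_insert_of_mem _) (Set.mem_insert_of_mem _)
    · rw [Finset.card_erase_of_mem hi]
      have := Finset.card_pos.2 ⟨i, hi⟩
      omega

theorem domWinsAsSecond_realizationGraph (hr : 2 ≤ r) (hrs : r ≤ s) (hst : s ≤ t) :
    DomWinsAsSecond (realizationGraph r s t) t ∅ ∅ := by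
  refine domWinsAsSecond_of_intact hr hst Finset.univ (by simp) (by simp) (by simp) (by simp)
    (by simp) (by simp) ?_
  rw [Finset.card_univ, Fintype.card_fin]; omega

/-! ### The three numbers of the realization graph -/

theorem dominationNumber_realizationGraph (hr : 2 ≤ r) :
    dominationNumber (realizationGraph r s t) = r := by
  have hinj : Function.Injective (RealizationVertex.x : Fin r → RealizationVertex r s t) :=
    fun _ _ h => RealizationVertex.x.inj h
  refine IsLeast.csInf_eq ⟨⟨Finset.univ.map ⟨_, hinj⟩, by simp, ?_⟩, ?_⟩
  · refine realizationGraph_isDominating hr ?_ ?_ ?_ fun i => ?_ <;> simp [spine]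
  · rintro n ⟨E, rfl, hE⟩
    exact le_card_of_isDominating hr hE

theorem gammaMB_realizationGraph (hr : 2 ≤ r) (hrs : r ≤ s) (hst : s ≤ t) :
    gammaMB (realizationGraph r s t) = s :=
  le_antisymm (iInf₂_le s (exists_winsWithin_zero_iff.2 (domWins_realizationGraph hr hrs)))
    (le_iInf₂ fun _ hk =>
      Nat.cast_le.2 (le_of_domWins hr hrs hst (exists_winsWithin_zero_iff.1 hk)))

theorem gammaMB'_realizationGraph (hr : 2 ≤ r) (hrs : r ≤ s) (hst : s ≤ t) :
    gammaMB' (realizationGraph r s t) = t :=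
  le_antisymm
    (iInf₂_le t (exists_winsWithin_one_iff.2 (domWinsAsSecond_realizationGraph hr hrs hst)))
    (le_iInf₂ fun _ hk =>
      Nat.cast_le.2 (le_of_domWinsAsSecond hr (hrs.trans hst) (exists_winsWithin_one_iff.1 hk)))

end Realization

end MBDomination

theorem theorem3p1 :
    (∀ (V : Type*) [Finite V] (G : SimpleGraph V),
      (MBDomination.dominationNumber G : ℕ∞) ≤ MBDomination.gammaMB G ∧
        MBDomination.gammaMB G ≤ MBDomination.gammaMB' G) ∧
    (∀ r s t : ℕ, 2 ≤ r → r ≤ s → s ≤ t →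
      MBDomination.dominationNumber (MBDomination.realizationGraph r s t) = r ∧
        MBDomination.gammaMB (MBDomination.realizationGraph r s t) = (s : ℕ∞) ∧
        MBDomination.gammaMB' (MBDomination.realizationGraph r s t) = (t : ℕ∞)) :=
  ⟨fun _ _ G => ⟨MBDomination.dominationNumber_le_gammaMB G, MBDomination.gammaMB_le_gammaMB' G⟩,
    fun _ _ _ hr hrs hst => ⟨MBDomination.dominationNumber_realizationGraph hr,
      MBDomination.gammaMB_realizationGraph hr hrs hst,
      MBDomination.gammaMB'_realizationGraph hr hrs hst⟩⟩
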